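/- **Setting.** Fix a schema of predicates with arities and a non-empty set $C$ of constants. A *rule* is an existential rule $\sigma:\ \forall\bar x\,(\varphi(\bar x)\to\exists\bar y\,\alpha(\bar x',\bar y))$, $\bar x'\subseteq\bar x$, with body a finite conjunction $\varphi$ of atoms and head a single atom $\alpha$ (terms are constants and variables); existential variables of different rules are regarded as different. A *database* $D$ is a finite set of facts over constants; in general facts may also contain labelled nulls. A *Boolean conjunctive query* (BCQ) $q$ is a finite conjunction of atoms, read existentially; $I\models q$ means that $q$ has a homomorphism (identity on constants) into the set $I$ of facts. A homomorphism between facts fixes constants and may send nulls to any terms. *Shy.* Let $\Sigma$ be a finite set of rules. The positions *invaded* by an existential variable $y$ form the least set containing every head position at which $y$ occurs, and every head position at which a universal variable occurs whose body occurrences are all in positions invaded by $y$. A universal variable of a rule is *attacked* by $y$ if it occurs in the body only in positions invaded by $y$, and *protected* if no existential variable attacks it. $\Sigma$ is Shy if in every rule (i) each variable occurring in more than one body atom is protected, and (ii) two distinct unprotected universal variables that both occur in the head and occur in two different body atoms are never attacked by the same variable. *Chase.* An applicable homomorphism of $\sigma$ in $I$ maps the body of $\sigma$ into $I$; firing it adds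 the head, with distinct fresh nulls for the existential variables. The *oblivious chase* $ochase(D,\Sigma)$ fires every applicable homomorphism once. An execution of the *parsimonious chase* $pchase(I,\Sigma)$ fires, in some order, applicable homomorphisms whose resulting fact $a$ satisfies the firing condition that there is no homomorphism from $\{a\}$ to the current set of facts, until no more can be fired. With $\lceil I\rfloor$ the result of replacing distinct nulls by distinct new constants (*freezing*), the *parsimonious chase with resumption* is $pchase_r(D,\Sigma,0)=D$, $pchase_r(D,\Sigma,i)=pchase(\lceil pchase_r(D,\Sigma,i-1)\rfloor,\Sigma)$. *Streaming chase.* For a set $I$ of facts and a predicate $p$, the *aggregate fact tree* $T_p$ is the tree whose nodes are the prefixes of argument tuples of $p$-facts of $I$ (no tree if there are none), with an edge from each prefix to its one-term extensions. $\mathrm{HomomorphismCheck}_S(a)$ for a fact $a=p(a_1,\dots,a_k)$ holds if there are no root-to-leaf path with terms $t_1,\dots,t_k$ in $T_p$ and no map $\theta$ fixing constants with $\theta(a_j)=t_j$ for all $j$. The streaming chase $chase_s(D,\Sigma)$ with $\mathit{maxRes}$ resumption iterations runs a pipeline with one node per rule. Each fact belongs to an iteration $1,\dots,\mathit{maxRes}$,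 each iteration has its own aggregate fact trees, and iteration $1$ starts with $D$. The steps, taken in any order until none is possible, are: the node of a rule pulls a not yet pulled fact of an iteration, with a predicate of its body, from the nodes producing it; the node of a rule fires an applicable homomorphism from its body to the facts it has pulled in an iteration, with nulls not used so far in any iteration, if the generated fact satisfies $\mathrm{HomomorphismCheck}_S$ for the trees of that iteration, whereupon the fact is added to the iteration and its trees; a fact of iteration $i<\mathit{maxRes}$ is frozen and, unless already present, proposed in (added to) iteration $i+1$ and its trees. The outcome is the set of facts of iteration $\mathit{maxRes}$. **Theorem.** Let $D$ be a database, $\Sigma$ a Shy set of rules, and $q$ a BCQ with $n$ distinct variables. Run both $pchase_r$ and $chase_s$, the latter with firing condition $\mathrm{HomomorphismCheck}_S$, with $\mathit{maxRes}=n+1$ iterations. Then $pchase_r$ has an execution with an outcome, every execution of $chase_s$ is finite, $chase_s$ has an execution with an outcome, and for every outcome $I$ of $pchase_r(D,\Sigma,n+1)$ and every outcome $J$ of $chase_s(D,\Sigma)$, whatever the order of rule activations in each, $$I\models q\iff J\models q,$$ and moreover $chase_s$ is correct for Boolean conjunctive query answering over Shy: $$ochase(D,\Sigma)\models q\iff J\models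 q.$$ -/

import Mathlib

namespace StreamingChase

/-! ### Terms, atoms, rules, queries -/

/-- Terms of rules and queries: constants and variables. -/
inductive Term (C V : Type*) where
  | const (c : C)
  | var (v : V)

/-- Terms of facts: the constants of the original vocabulary, the constants obtained by freezing
the null labelled `n`, and the labelled nulls. -/
inductive GTerm (C N : Type*) where
  | const (c : C)
  | frozen (n : N)
  | null (n : N)

/-- Atoms over a schema with predicates `P` of arities `ar` and with terms in `T`. -/
structure Atom {P : Type*} (ar : P → ℕ) (T : Type*) where
  pred : P
  args : Fin (ar pred) → T

section Language

variable {P : Type*} {ar : P → ℕ} {C V N T T' : Type*}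

/-- Apply a map of terms to an atom. -/
def Atom.map (f : T → T') (a : Atom ar T) : Atom ar T' := ⟨a.pred, fun i => f (a.args i)⟩

/-- The variable `x` occurs in the atom `a`. -/
def Atom.HasVar (a : Atom ar (Term C V)) (x : V) : Prop := ∃ i, a.args i = Term.var x

/-- The value of a term under an assignment of the variables. -/
def Term.subst (θ : V → GTerm C N) : Term C V → GTerm C N
  | .const c => .const c
  | .var v => θ v

/-- An existential rule with a single head atom. The variables of the head that do not occur in the
body are existentially quantified, all the variables of the body universally. -/
structure Rule {P : Type*} (ar : P → ℕ) (C V : Type*) where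
  body : Finset (Atom ar (Term C V))
  head : Atom ar (Term C V)

/-- The universally quantified variables of a rule. -/
def Rule.bodyVars (σ : Rule ar C V) : Set V := {x | ∃ b ∈ σ.body, b.HasVar x}

/-- The existentially quantified variables of a rule. -/
def Rule.existVars (σ : Rule ar C V) : Set V := {x | σ.head.HasVar x ∧ x ∉ σ.bodyVars}

/-- A Boolean conjunctive query: the existential closure of a finite conjunction of atoms. -/
abbrev BCQ {P : Type*} (ar : P → ℕ) (C V : Type*) := Finset (Atom ar (Term C V))

/-- The number of variables of a query. -/
noncomputable def numVars (q : BCQ ar C V) : ℕ := {x : V | ∃ a ∈ q, a.HasVar x}.ncard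

/-- A set of facts entails a query if the query has a homomorphism into it. -/
def Entails (I : Set (Atom ar (GTerm C N))) (q : BCQ ar C V) : Prop :=
  ∃ θ : V → GTerm C N, ∀ a ∈ q, a.map (Term.subst θ) ∈ I

/-! ### Shy sets of rules -/

/-- `Invaded S τ y p i`: the position `i` of `p` is invaded by the existential variable `y` of the
rule `τ ∈ S`. Existential variables of different rules count as different. -/
inductive Invaded (S : Finset (Rule ar C V)) (τ : Rule ar C V) (y : V) :
    (p : P) → Fin (ar p) → Prop where
  | exist (hτ : τ ∈ S) (hy : y ∈ τ.existVars) (i : Fin (ar τ.head.pred))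
      (hi : τ.head.args i = Term.var y) : Invaded S τ y τ.head.pred i
  | propagate (σ : Rule ar C V) (hσ : σ ∈ S) (x : V) (hx : x ∈ σ.bodyVars)
      (i : Fin (ar σ.head.pred)) (hi : σ.head.args i = Term.var x)
      (h : ∀ b ∈ σ.body, ∀ j, b.args j = Term.var x → Invaded S τ y b.pred j) :
      Invaded S τ y σ.head.pred i

/-- The universal variable `x` of `σ` is attacked by the existential variable `y` of `τ`: it occurs
in the body only in positions invaded by `y`. -/
def Attacked (S : Finset (Rule ar C V)) (τ : Rule ar C V) (y : V) (σ : Rule ar C V) (x : V) :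
    Prop :=
  x ∈ σ.bodyVars ∧ ∀ b ∈ σ.body, ∀ j, b.args j = Term.var x → Invaded S τ y b.pred j

/-- A universal variable is protected if no existential variable attacks it. -/
def IsProtected (S : Finset (Rule ar C V)) (σ : Rule ar C V) (x : V) : Prop :=
  ∀ τ y, ¬ Attacked S τ y σ x

/-- Shy sets of rules. -/
def Shy (S : Finset (Rule ar C V)) : Prop :=
  ∀ σ ∈ S,
    (∀ x, ∀ a ∈ σ.body, ∀ b ∈ σ.body, a ≠ b → a.HasVar x → b.HasVar x → IsProtected S σ x) ∧
    (∀ x z, x ≠ z → ¬ IsProtected S σ x → ¬ IsProtected S σ z →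
      σ.head.HasVar x → σ.head.HasVar z →
      (∃ a ∈ σ.body, ∃ b ∈ σ.body, a ≠ b ∧ a.HasVar x ∧ b.HasVar z) →
      ∀ τ y, ¬ (Attacked S τ y σ x ∧ Attacked S τ y σ z))

/-- An applicable homomorphism of `σ` in `I`: it maps the body of `σ` into `I`. (Its values at
other variables than those of the body play no role here.) -/
def Applicable (σ : Rule ar C V) (θ : V → GTerm C N) (I : Set (Atom ar (GTerm C N))) : Prop :=
  ∀ b ∈ σ.body, b.map (Term.subst θ) ∈ I

/-- A database, a finite set of facts without nulls, as a set of facts. -/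
def database (D : Finset (Atom ar C)) : Set (Atom ar (GTerm C N)) :=
  {a | ∃ d ∈ D, a = d.map GTerm.const}

end Language

/-! ### The oblivious chase -/

/-- The nulls of the oblivious chase: `mk σ y θ` is the null created for the existential variable
`y` when the rule `σ` is fired with the homomorphism `θ` from its body (`none` outside the variables
of the body). So every homomorphism is fired exactly once, with its own new nulls. -/
inductive ONull {P : Type*} (ar : P → ℕ) (C V : Type*) where
  | mk (σ : Rule ar C V) (y : V) (θ : V → Option (GTerm C (ONull ar C V)))

section Oblivious

variable {P : Type*} {ar : P → ℕ} {C V : Type*}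

open Classical in
/-- Extension of a homomorphism from the body of `σ` to the other variables by its new nulls. -/
noncomputable def oExtend (σ : Rule ar C V) (θ : V → GTerm C (ONull ar C V)) :
    V → GTerm C (ONull ar C V) :=
  fun v => if v ∈ σ.bodyVars then θ v
    else GTerm.null (ONull.mk σ v fun w => if w ∈ σ.bodyVars then some (θ w) else none)

/-- The oblivious chase: all facts obtained from the database by firing rules with all applicable
homomorphisms. -/
inductive OChase (D : Finset (Atom ar C)) (S : Finset (Rule ar C V)) :
    Atom ar (GTerm C (ONull ar C V)) → Prop where
  | base (d : Atom ar C) (hd : d ∈ D) : OChase D S (d.map GTerm.const)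
  | fire (σ : Rule ar C V) (hσ : σ ∈ S) (θ : V → GTerm C (ONull ar C V))
      (h : ∀ b ∈ σ.body, OChase D S (b.map (Term.subst θ))) :
      OChase D S (σ.head.map (Term.subst (oExtend σ θ)))

/-- The oblivious chase as a set of facts. -/
def ochase (D : Finset (Atom ar C)) (S : Finset (Rule ar C V)) :
    Set (Atom ar (GTerm C (ONull ar C V))) :=
  {a | OChase D S a}

end Oblivious

/-! ### The parsimonious chase with resumption -/

section Parsimonious

variable {P : Type*} {ar : P → ℕ} {C V : Type*}

/-- Facts with nulls labelled by natural numbers. -/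
abbrev Fact {P : Type*} (ar : P → ℕ) (C : Type*) := Atom ar (GTerm C ℕ)

/-- A homomorphism of ground terms fixes all constants (original and frozen ones) and is free on
nulls. -/
def IsHom (g : GTerm C ℕ → GTerm C ℕ) : Prop :=
  (∀ c, g (.const c) = .const c) ∧ ∀ n, g (.frozen n) = .frozen n

/-- The labels used in a set of facts, by nulls or by frozen nulls. -/
def labels (I : Set (Fact ar C)) : Set ℕ :=
  {n | ∃ a ∈ I, ∃ i, a.args i = .null n ∨ a.args i = .frozen n}

/-- `θ` maps the existential variables of `σ` injectively to nulls with labels outside `L`. -/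
def FreshOn (σ : Rule ar C V) (θ : V → GTerm C ℕ) (L : Set ℕ) : Prop :=
  (∀ y ∈ σ.existVars, ∃ n, n ∉ L ∧ θ y = .null n) ∧ Set.InjOn θ σ.existVars

/-- The firing condition of the parsimonious chase: the fact `a` has no homomorphism into `I`. -/
def HomomorphismCheck (I : Set (Fact ar C)) (a : Fact ar C) : Prop :=
  ¬ ∃ g, IsHom g ∧ a.map g ∈ I

/-- One step of the parsimonious chase: an applicable homomorphism, extended by fresh nulls, whose
head satisfies the firing condition is fired. -/
def PStep (S : Finset (Rule ar C V)) (I I' : Set (Fact ar C)) : Prop :=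
  ∃ σ ∈ S, ∃ θ : V → GTerm C ℕ, Applicable σ θ I ∧ FreshOn σ θ (labels I) ∧
    HomomorphismCheck I (σ.head.map (Term.subst θ)) ∧
    I' = insert (σ.head.map (Term.subst θ)) I

/-- `J` is the outcome of an execution (with some order of rule activations) of the parsimonious
chase on the set `I` of facts. -/
def IsPChase (I : Set (Fact ar C)) (S : Finset (Rule ar C V)) (J : Set (Fact ar C)) : Prop :=
  Relation.ReflTransGen (PStep S) I J ∧ ∀ J', ¬ PStep S J J'

/-- Freezing turns nulls into constants. -/
def GTerm.freeze : GTerm C ℕ → GTerm C ℕ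
  | .const c => .const c
  | .frozen n => .frozen n
  | .null n => .frozen n

/-- `IsPChaseR D S r I`: `I` is the outcome of an execution of the parsimonious chase with
resumption with `r` iterations, each of which is run on the frozen outcome of the previous one. -/
inductive IsPChaseR (D : Finset (Atom ar C)) (S : Finset (Rule ar C V)) :
    ℕ → Set (Fact ar C) → Prop where
  | zero : IsPChaseR D S 0 (database D)
  | succ (r : ℕ) (I J : Set (Fact ar C)) (hI : IsPChaseR D S r I)
      (hJ : IsPChase (Atom.map GTerm.freeze '' I) S J) : IsPChaseR D S (r + 1) J

end Parsimonious

/-! ### The streaming chase -/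

section Streaming

variable {P : Type*} {ar : P → ℕ} {C V : Type*}

/-- An aggregate fact tree, given by its node labels: the label of a node is the tuple of terms on
the path from the root, whose label is `[]`, and there is an edge labelled `x` from `l` to
`l ++ [x]`. The empty set stands for a tree that has not been created. -/
abbrev AFTree (C : Type*) := Set (List (GTerm C ℕ))

/-- The leaves of an aggregate fact tree. -/
def AFTree.IsLeaf (T : AFTree C) (t : List (GTerm C ℕ)) : Prop := t ∈ T ∧ ∀ x, t ++ [x] ∉ T

/-- A firing condition of the streaming chase decides on a fact by the aggregate fact trees, one per
predicate, of the facts generated so far. -/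
abbrev FiringCondition {P : Type*} (ar : P → ℕ) (C : Type*) :=
  (P → AFTree C) → Fact ar C → Prop

/-- The streaming homomorphism check: the tree of the predicate of `a` has no root-to-leaf path onto
which a homomorphism maps the terms of `a` position by position. -/
def HomomorphismCheckS : FiringCondition ar C := fun T a =>
  ¬ ∃ g, IsHom g ∧ ∃ t, (T a.pred).IsLeaf t ∧ (List.ofFn a.args).map g = t

/-- A state of the pipeline that a set of rules is compiled to. The pipeline has a node for each
rule, and facts are streamed to it from all nodes that produce a predicate of its body. Every fact
belongs to a resumption iteration. -/
structure State {P : Type*} (ar : P → ℕ) (C V : Type*) where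
  /-- the facts streamed in an iteration -/
  facts : ℕ → Set (Fact ar C)
  /-- the aggregate fact trees of an iteration -/
  trees : ℕ → P → AFTree C
  /-- the facts of an iteration that the node of a rule has pulled so far -/
  pulled : ℕ → Rule ar C V → Set (Fact ar C)

/-- The state after the fact `a` has been added to iteration `i`, and its path to the tree of its
predicate. -/
def State.emit (s : State ar C V) (i : ℕ) (a : Fact ar C) : State ar C V where
  facts := fun j => {b | b ∈ s.facts j ∨ j = i ∧ b = a}
  trees := fun j p => {l | l ∈ s.trees j p ∨ j = i ∧ p = a.pred ∧ l <+: List.ofFn a.args}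
  pulled := s.pulled

/-- The state after the node of `σ` has pulled the fact `a` in iteration `i`. -/
def State.pull (s : State ar C V) (i : ℕ) (σ : Rule ar C V) (a : Fact ar C) : State ar C V where
  facts := s.facts
  trees := s.trees
  pulled := fun j τ => {b | b ∈ s.pulled j τ ∨ j = i ∧ τ = σ ∧ b = a}

/-- The labels used in a state. -/
def State.labels (s : State ar C V) : Set ℕ := {n | ∃ i, n ∈ StreamingChase.labels (s.facts i)}

/-- The initial state: the facts of the database are streamed in iteration `1`. -/
def State.init (D : Finset (Atom ar C)) : State ar C V where
  facts := fun i => {a | i = 1 ∧ a ∈ database D}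
  trees := fun i p => {l | i = 1 ∧ ∃ a ∈ (database D : Set (Fact ar C)),
    a.pred = p ∧ l <+: List.ofFn a.args}
  pulled := fun _ _ => ∅

/-- The steps of the streaming chase with firing condition `F` and `maxRes` iterations. Any order of
the steps is allowed, in particular any scheduling of the nodes of the pipeline, and an iteration
need not wait until the previous one is complete. -/
inductive SStep (S : Finset (Rule ar C V)) (F : FiringCondition ar C) (maxRes : ℕ) :
    State ar C V → State ar C V → Prop where
  /-- The node of `σ` pulls a new fact from one of the nodes it depends on. -/
  | pull (s : State ar C V) (i : ℕ) (σ : Rule ar C V) (hσ : σ ∈ S) (a : Fact ar C)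
      (ha : a ∈ s.facts i) (hp : ∃ b ∈ σ.body, b.pred = a.pred) (hn : a ∉ s.pulled i σ) :
      SStep S F maxRes s (s.pull i σ a)
  /-- The node of `σ` fires a homomorphism from the body of `σ` to the facts it has pulled, provided
  that the generated fact satisfies the firing condition. -/
  | fire (s : State ar C V) (i : ℕ) (σ : Rule ar C V) (hσ : σ ∈ S) (θ : V → GTerm C ℕ)
      (hi : 1 ≤ i ∧ i ≤ maxRes) (hθ : Applicable σ θ (s.pulled i σ))
      (hfresh : FreshOn σ θ s.labels)
      (hF : F (s.trees i) (σ.head.map (Term.subst θ))) :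
      SStep S F maxRes s (s.emit i (σ.head.map (Term.subst θ)))
  /-- A fact of an iteration is frozen and proposed in the next iteration. -/
  | resume (s : State ar C V) (i : ℕ) (hi : 1 ≤ i ∧ i < maxRes) (a : Fact ar C)
      (ha : a ∈ s.facts i) (hn : a.map GTerm.freeze ∉ s.facts (i + 1)) :
      SStep S F maxRes s (s.emit (i + 1) (a.map GTerm.freeze))

/-- `J` is the outcome of an execution of the streaming chase: the facts of the last iteration in a
state in which no step is possible any more. -/
def IsStreamingChase (D : Finset (Atom ar C)) (S : Finset (Rule ar C V))
    (F : FiringCondition ar C) (maxRes : ℕ) (J : Set (Fact ar C)) : Prop :=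
  ∃ s : State ar C V, Relation.ReflTransGen (SStep S F maxRes) (State.init D) s ∧
    (∀ s', ¬ SStep S F maxRes s s') ∧ J = s.facts maxRes

/-- Every execution of the streaming chase is finite. -/
def StreamingChaseTerminates (D : Finset (Atom ar C)) (S : Finset (Rule ar C V))
    (F : FiringCondition ar C) (maxRes : ℕ) : Prop :=
  ¬ ∃ run : ℕ → State ar C V, run 0 = State.init D ∧ ∀ k, SStep S F maxRes (run k) (run (k + 1))

end Streaming

end StreamingChase

namespace StreamingChase

/-! ### Maps of terms and atoms -/

section Maps

variable {P : Type*} {ar : P → ℕ} {C V N M T T' : Type*}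

/-! Each of the two chases is shown to entail the same queries as the oblivious chase, so their
mutual equivalence is a consequence.

Soundness needs no Shyness. One map from labels to terms of the oblivious chase, applied alike to a
null and to its frozen copy, sends all generated facts into the oblivious chase; a firing with fresh
nulls only extends it (`MapsToOChase.exists_extension`).

Completeness is where Shy and resumption enter. A single closed iteration receives a homomorphism
from each oblivious fact separately, but two facts may disagree on a common null, so joins of a
query can be lost. `Covers D S N I` demands agreement on a set `N` of nulls, with images that are
not nulls. The last of `r + 1` iterations covers every `N` with at most `r` nulls
(`IterationChain.covers`): cover all but the newest null of `N` in the previous iteration, read off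
an image of the newest one from the fact that creates it, and freeze everything (`Covers.resume`).
The facts creating nulls of `N` survive freezing; all others follow by induction along the oblivious
chase (`exists_lift_of_shy`), because homomorphisms of the firing condition cannot move frozen
images. A match of a query with `n` variables involves at most `n` nulls, whence `n + 1` iterations.

Termination holds because, within an iteration, fired facts outside the finite set of database and
resumed facts have pairwise different patterns, of which there are finitely many
(`finite_iUnion_of_fire`). -/

theorem Atom.map_congr {f g : T → T'} {a : Atom ar T}
    (h : ∀ i, f (a.args i) = g (a.args i)) : a.map f = a.map g := by
  simp [Atom.map, h]

theorem Atom.map_subst_congr {θ θ' : V → GTerm C N} {a : Atom ar (Term C V)}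
    (h : ∀ x, a.HasVar x → θ x = θ' x) : a.map (Term.subst θ) = a.map (Term.subst θ') := by
  refine Atom.map_congr fun i => ?_
  cases hi : a.args i with
  | const c => rfl
  | var x => exact h x ⟨i, hi⟩

theorem Atom.map_subst_map {f : GTerm C N → GTerm C M} (hf : ∀ c, f (.const c) = .const c)
    (θ : V → GTerm C N) (a : Atom ar (Term C V)) :
    (a.map (Term.subst θ)).map f = a.map (Term.subst (f ∘ θ)) := by
  change a.map (f ∘ Term.subst θ) = _
  refine Atom.map_congr fun i => ?_
  cases hi : a.args i with
  | const c => exact hf c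
  | var x => rfl

/-- The map of ground terms that fixes the original constants and treats frozen nulls as nulls. -/
def GTerm.lift (h : N → GTerm C M) : GTerm C N → GTerm C M
  | .const c => .const c
  | .frozen n => h n
  | .null n => h n

theorem IsHom.apply_of_ne_null {g : GTerm C ℕ → GTerm C ℕ} (hg : IsHom g) {t : GTerm C ℕ}
    (ht : ∀ k, t ≠ .null k) : g t = t := by
  cases t with
  | const c => exact hg.1 c
  | frozen n => exact hg.2 n
  | null n => exact absurd rfl (ht n)

theorem GTerm.freeze_ne_null (t : GTerm C ℕ) (k : ℕ) : t.freeze ≠ .null k := by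
  cases t <;> simp [GTerm.freeze]

theorem GTerm.lift_freeze_comp (g : N → GTerm C ℕ) (t : GTerm C N) :
    t.lift (GTerm.freeze ∘ g) = (t.lift g).freeze := by
  cases t <;> rfl

theorem Rule.mem_existVars_of_not_mem {σ : Rule ar C V} {x : V} {i : Fin (ar σ.head.pred)}
    (hi : σ.head.args i = .var x) (hx : x ∉ σ.bodyVars) : x ∈ σ.existVars :=
  ⟨⟨i, hi⟩, hx⟩

end Maps

/-! ### Nulls of the oblivious chase -/

section Nulls

variable {P : Type*} {ar : P → ℕ} {C V : Type*}

open Classical in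
/-- The part of a homomorphism that the nulls of the oblivious chase record. -/
noncomputable def bodyPart (σ : Rule ar C V) (θ : V → GTerm C (ONull ar C V)) :
    V → Option (GTerm C (ONull ar C V)) :=
  fun w => if w ∈ σ.bodyVars then some (θ w) else none

theorem oExtend_of_mem {σ : Rule ar C V} {x : V} (hx : x ∈ σ.bodyVars)
    (θ : V → GTerm C (ONull ar C V)) : oExtend σ θ x = θ x := by
  simp [oExtend, hx]

theorem oExtend_of_not_mem {σ : Rule ar C V} {x : V} (hx : x ∉ σ.bodyVars)
    (θ : V → GTerm C (ONull ar C V)) :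
    oExtend σ θ x = .null (.mk σ x (bodyPart σ θ)) := by
  simp only [oExtend, hx, if_false]
  rfl

theorem oExtend_eq_of_bodyPart_eq {σ : Rule ar C V} {θ θ' : V → GTerm C (ONull ar C V)}
    (h : bodyPart σ θ = bodyPart σ θ') : oExtend σ θ = oExtend σ θ' := by
  funext x
  by_cases hx : x ∈ σ.bodyVars
  · have := congrFun h x
    simpa [bodyPart, hx, oExtend] using this
  · rw [oExtend_of_not_mem hx, oExtend_of_not_mem hx, h]

/-- The null `μ` occurs in the homomorphism recorded by `ν`. -/
inductive ONull.Older : ONull ar C V → ONull ar C V → Prop where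
  | intro (μ : ONull ar C V) (σ : Rule ar C V) (y v : V)
      (η : V → Option (GTerm C (ONull ar C V))) (h : η v = some (.null μ)) : Older μ (.mk σ y η)

theorem ONull.older_wf : WellFounded (ONull.Older (ar := ar) (C := C) (V := V)) := by
  refine ⟨fun ν => ?_⟩
  -- `ONull` is a nested inductive type: the motives for options and terms transport accessibility
  -- from a null to the homomorphism value containing it.
  refine ONull.rec (motive_1 := fun ν => Acc ONull.Older ν)
    (motive_2 := fun o => ∀ μ, o = some (.null μ) → Acc ONull.Older μ)
    (motive_3 := fun t => ∀ μ, t = .null μ → Acc ONull.Older μ) ?_ ?_ ?_ ?_ ?_ ?_ ν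
  · intro σ y η ih
    refine ⟨_, fun μ hμ => ?_⟩
    obtain ⟨_, _, v, _, h⟩ := hμ
    exact ih v μ h
  · intro μ h; cases h
  · intro t ih μ h; exact ih μ (Option.some.inj h)
  · intro c μ h; cases h
  · intro n _ μ h; cases h
  · intro n ih μ h; cases h; exact ih

theorem ONull.older_of_body {σ : Rule ar C V} {x : V} (hx : x ∈ σ.bodyVars)
    {θ : V → GTerm C (ONull ar C V)} {μ : ONull ar C V} (h : θ x = .null μ) (y : V) :
    ONull.Older μ (.mk σ y (bodyPart σ θ)) :=
  .intro _ _ _ x _ (by simp [bodyPart, hx, h])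

/-- Every term of the oblivious chase is a constant, or a null at a position that is invaded by the
existential variable of the null. -/
theorem OChase.const_or_invaded {D : Finset (Atom ar C)} {S : Finset (Rule ar C V)}
    {a : Atom ar (GTerm C (ONull ar C V))} (ha : OChase D S a) (i : Fin (ar a.pred)) :
    (∃ c, a.args i = .const c) ∨
      ∃ τ y η, a.args i = .null (.mk τ y η) ∧ Invaded S τ y a.pred i := by
  induction ha with
  | base d hd => exact .inl ⟨_, rfl⟩
  | fire σ hσ θ h ih =>
    change Fin (ar σ.head.pred) at i
    change (∃ c, Term.subst (oExtend σ θ) (σ.head.args i) = .const c) ∨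
      ∃ τ y η, Term.subst (oExtend σ θ) (σ.head.args i) = .null (.mk τ y η) ∧
        Invaded S τ y σ.head.pred i
    cases hi : σ.head.args i with
    | const c => exact .inl ⟨c, rfl⟩
    | var x =>
      simp only [Term.subst]
      by_cases hx : x ∈ σ.bodyVars
      · rw [oExtend_of_mem hx]
        -- All body occurrences of `x` carry the same term, so the existential variable of one null
        -- invades all of these positions, as `Invaded.propagate` requires.
        have key : ∀ b ∈ σ.body, ∀ j, b.args j = .var x → (∃ c, θ x = .const c) ∨
            ∃ τ y η, θ x = .null (.mk τ y η) ∧ Invaded S τ y b.pred j := by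
          intro b hb j hj
          have := ih b hb j
          simpa only [Atom.map, hj, Term.subst] using this
        obtain ⟨b, hb, j, hj⟩ := id hx
        rcases key b hb j hj with hc | ⟨τ, y, η, hn, -⟩
        · exact .inl hc
        · refine .inr ⟨τ, y, η, hn, .propagate σ hσ x hx i hi fun b' hb' j' hj' => ?_⟩
          rcases key b' hb' j' hj' with ⟨c, hc⟩ | ⟨τ', y', η', hn', hinv⟩
          · rw [hn] at hc; cases hc
          · rw [hn] at hn'; cases hn'; exact hinv
      · rw [oExtend_of_not_mem hx]
        exact .inr ⟨σ, x, _, rfl, .exist hσ (Rule.mem_existVars_of_not_mem hi hx) i hi⟩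

/-- A variable of the body is mapped into the oblivious chase to a constant, or to a null whose
existential variable attacks it. -/
theorem OChase.const_or_attacked {D : Finset (Atom ar C)} {S : Finset (Rule ar C V)}
    {σ : Rule ar C V} {θ : V → GTerm C (ONull ar C V)}
    (h : ∀ b ∈ σ.body, OChase D S (b.map (Term.subst θ))) {x : V} (hx : x ∈ σ.bodyVars) :
    (∃ c, θ x = .const c) ∨ ∃ τ y η, θ x = .null (.mk τ y η) ∧ Attacked S τ y σ x := by
  have key : ∀ b ∈ σ.body, ∀ j, b.args j = .var x → (∃ c, θ x = .const c) ∨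
      ∃ τ y η, θ x = .null (.mk τ y η) ∧ Invaded S τ y b.pred j := by
    intro b hb j hj
    have := (h b hb).const_or_invaded j
    simpa only [Atom.map, hj, Term.subst] using this
  obtain ⟨b, hb, j, hj⟩ := id hx
  rcases key b hb j hj with hc | ⟨τ, y, η, hn, -⟩
  · exact .inl hc
  · refine .inr ⟨τ, y, η, hn, hx, fun b' hb' j' hj' => ?_⟩
    rcases key b' hb' j' hj' with ⟨c, hc⟩ | ⟨τ', y', η', hn', hinv⟩
    · rw [hn] at hc; cases hc
    · rw [hn] at hn'; cases hn'; exact hinv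

end Nulls

/-! ### Completeness -/

section Completeness

variable {P : Type*} {ar : P → ℕ} {C V : Type*}

/-- Every applicable homomorphism is satisfied in `J` up to a homomorphism of the generated fact. -/
def ParsimoniouslyClosed (S : Finset (Rule ar C V)) (J : Set (Fact ar C)) : Prop :=
  ∀ σ ∈ S, ∀ θ : V → GTerm C ℕ, Applicable σ θ J →
    ∃ g, IsHom g ∧ ∃ ψ : V → GTerm C ℕ, (∀ x ∈ σ.bodyVars, ψ x = g (θ x)) ∧
      σ.head.map (Term.subst ψ) ∈ J

/-- The gluing step. By condition (i) of Shy a variable shared by two body atoms has a constant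
value, so the separate homomorphisms of the atoms combine into one of the body. Closedness then
supplies an image of the head, and condition (ii) makes it depend only on the null and not on the
variable carrying it. Firings that create nulls of `N` are left out by `hN`, as closedness does not
control the images of new nulls. -/
theorem exists_lift_of_shy [Nonempty C] {D : Finset (Atom ar C)} {S : Finset (Rule ar C V)}
    (hS : Shy S) {J : Set (Fact ar C)} (hJ : ParsimoniouslyClosed S J)
    {N : Set (ONull ar C V)} {m : ONull ar C V → GTerm C ℕ} (hm : ∀ ν ∈ N, ∀ k, m ν ≠ .null k)
    {σ : Rule ar C V} (hσ : σ ∈ S) {θ : V → GTerm C (ONull ar C V)}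
    (h : ∀ b ∈ σ.body, OChase D S (b.map (Term.subst θ)))
    (hN : ∀ y ∈ σ.existVars, .mk σ y (bodyPart σ θ) ∉ N)
    (ih : ∀ b ∈ σ.body, ∃ g, Set.EqOn g m N ∧
      (b.map (Term.subst θ)).map (GTerm.lift g) ∈ J) :
    ∃ g, Set.EqOn g m N ∧ (σ.head.map (Term.subst (oExtend σ θ))).map (GTerm.lift g) ∈ J := by
  classical
  have : Nonempty (GTerm C ℕ) := ⟨.const (Classical.arbitrary C)⟩
  choose! g hgm hgJ using ih
  -- `β x` is some body atom containing `x`, whose homomorphism decides the value of `x`; the head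
  -- is a dummy value for the other variables.
  have hβ : ∀ x, ∃ b, x ∈ σ.bodyVars → b ∈ σ.body ∧ b.HasVar x := fun x => by
    by_cases hx : x ∈ σ.bodyVars
    · obtain ⟨b, hb⟩ := id hx
      exact ⟨b, fun _ => hb⟩
    · exact ⟨σ.head, fun h => absurd h hx⟩
  choose β hβ using hβ
  set θ' : V → GTerm C ℕ := fun x => (θ x).lift (g (β x)) with hθ'
  have happ : Applicable σ θ' J := by
    intro b hb
    have : b.map (Term.subst θ') = (b.map (Term.subst θ)).map (GTerm.lift (g b)) := by
      rw [Atom.map_subst_map fun _ => rfl]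
      refine Atom.map_subst_congr fun x hx => ?_
      have hxb : x ∈ σ.bodyVars := ⟨b, hb, hx⟩
      rcases OChase.const_or_attacked h hxb with ⟨c, hc⟩ | ⟨τ, y, η, -, hat⟩
      · simp [hθ', hc, GTerm.lift]
      · by_cases hne : β x = b
        · simp [hθ', hne]
        · exact absurd hat ((hS σ hσ).1 x _ (hβ x hxb).1 b hb hne (hβ x hxb).2 hx τ y)
    rw [this]
    exact hgJ b hb
  obtain ⟨k, hk, ψ, hψ, hψJ⟩ := hJ σ hσ θ' happ
  have hwd : ∀ x z, σ.head.HasVar x → σ.head.HasVar z → ∀ ν, oExtend σ θ x = .null ν →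
      oExtend σ θ z = .null ν → ψ x = ψ z := by
    intro x z hx hz ν hxν hzν
    by_cases hxz : x = z
    · rw [hxz]
    by_cases hxb : x ∈ σ.bodyVars <;> by_cases hzb : z ∈ σ.bodyVars
    · rw [oExtend_of_mem hxb] at hxν
      rw [oExtend_of_mem hzb] at hzν
      -- The existential variable of the common null attacks both `x` and `z`, so condition (ii)
      -- excludes two different atoms.
      have hβxz : β x = β z := by
        by_contra hne
        rcases OChase.const_or_attacked h hxb with ⟨c, hc⟩ | ⟨τ, y, η, hη, hat⟩
        · rw [hc] at hxν; cases hxν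
        rcases OChase.const_or_attacked h hzb with ⟨c, hc⟩ | ⟨τ', y', η', hη', hat'⟩
        · rw [hc] at hzν; cases hzν
        rw [hxν] at hη; rw [hzν] at hη'
        cases hη; cases hη'
        exact (hS σ hσ).2 x z hxz (fun hp => hp _ _ hat) (fun hp => hp _ _ hat') hx hz
          ⟨_, (hβ x hxb).1, _, (hβ z hzb).1, hne, (hβ x hxb).2, (hβ z hzb).2⟩ _ _ ⟨hat, hat'⟩
      rw [hψ x hxb, hψ z hzb]
      simp [hθ', hxν, hzν, hβxz]
    · rw [oExtend_of_mem hxb] at hxν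
      rw [oExtend_of_not_mem hzb] at hzν
      cases hzν
      -- A null created by this firing cannot occur in the body homomorphism that it records.
      exact absurd (ONull.older_of_body hxb hxν z) (ONull.older_wf.irrefl.irrefl _)
    · rw [oExtend_of_mem hzb] at hzν
      rw [oExtend_of_not_mem hxb] at hxν
      cases hxν
      exact absurd (ONull.older_of_body hzb hzν x) (ONull.older_wf.irrefl.irrefl _)
    · rw [oExtend_of_not_mem hxb] at hxν
      rw [oExtend_of_not_mem hzb, ← hxν] at hzν
      cases hzν
      exact absurd rfl hxz
  have hG : ∀ ν, ∃ t : GTerm C ℕ, (ν ∈ N → t = m ν) ∧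
      ∀ x, σ.head.HasVar x → oExtend σ θ x = .null ν → t = ψ x := by
    intro ν
    by_cases hν : ν ∈ N
    · refine ⟨m ν, fun _ => rfl, fun x hx hxν => ?_⟩
      by_cases hxb : x ∈ σ.bodyVars
      · rw [oExtend_of_mem hxb] at hxν
        have : θ' x = m ν := by
          simp only [hθ', hxν, GTerm.lift]
          exact hgm _ (hβ x hxb).1 hν
        -- The prescribed images must not be nulls here: otherwise `k` could move them.
        rw [hψ x hxb, this, hk.apply_of_ne_null (hm ν hν)]
      · rw [oExtend_of_not_mem hxb] at hxν
        cases hxν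
        exact absurd hν (hN x ⟨hx, hxb⟩)
    · by_cases hx : ∃ x, σ.head.HasVar x ∧ oExtend σ θ x = .null ν
      · obtain ⟨x, hx, hxν⟩ := hx
        exact ⟨ψ x, fun h => absurd h hν, fun z hz hzν => hwd x z hx hz ν hxν hzν⟩
      · exact ⟨.const (Classical.arbitrary C), fun h => absurd h hν,
          fun z hz hzν => absurd ⟨z, hz, hzν⟩ hx⟩
  choose G hGm hGψ using hG
  refine ⟨G, fun ν hν => hGm ν hν, ?_⟩
  have : (σ.head.map (Term.subst (oExtend σ θ))).map (GTerm.lift G) =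
      σ.head.map (Term.subst ψ) := by
    rw [Atom.map_subst_map fun _ => rfl]
    refine Atom.map_subst_congr fun x hx => ?_
    by_cases hxb : x ∈ σ.bodyVars
    · rcases OChase.const_or_attacked h hxb with ⟨c, hc⟩ | ⟨τ, y, η, hη, -⟩
      · have : θ' x = .const c := by simp [hθ', hc, GTerm.lift]
        rw [hψ x hxb, this, hk.1]
        simp [oExtend_of_mem hxb, hc, GTerm.lift]
      · have : oExtend σ θ x = .null (.mk τ y η) := by rw [oExtend_of_mem hxb, hη]
        simp only [Function.comp, this, GTerm.lift]
        exact hGψ _ x hx this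
    · have := oExtend_of_not_mem hxb θ
      simp only [Function.comp, this, GTerm.lift]
      exact hGψ _ x hx this
  rwa [this]

/-- Each fact of the oblivious chase has a homomorphism into `I`, with a common choice of the images
of the nulls in `N` that does not use nulls. -/
def Covers (D : Finset (Atom ar C)) (S : Finset (Rule ar C V)) (N : Set (ONull ar C V))
    (I : Set (Fact ar C)) : Prop :=
  ∃ m : ONull ar C V → GTerm C ℕ, (∀ ν ∈ N, ∀ k, m ν ≠ .null k) ∧
    ∀ a, OChase D S a → ∃ g, Set.EqOn g m N ∧ a.map (GTerm.lift g) ∈ I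

/-- Induction along the oblivious chase reduces coverage to the facts whose firing creates a null of
`N`; gluing deals with every other firing. -/
theorem covers_of_births [Nonempty C] {D : Finset (Atom ar C)} {S : Finset (Rule ar C V)}
    (hS : Shy S) {J : Set (Fact ar C)} (hD : database D ⊆ J) (hJ : ParsimoniouslyClosed S J)
    {N : Set (ONull ar C V)} (m : ONull ar C V → GTerm C ℕ) (hm : ∀ ν ∈ N, ∀ k, m ν ≠ .null k)
    (hN : ∀ σ ∈ S, ∀ θ : V → GTerm C (ONull ar C V),
      (∀ b ∈ σ.body, OChase D S (b.map (Term.subst θ))) →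
      ∀ y ∈ σ.existVars, .mk σ y (bodyPart σ θ) ∈ N → ∃ g, Set.EqOn g m N ∧
        (σ.head.map (Term.subst (oExtend σ θ))).map (GTerm.lift g) ∈ J) :
    Covers D S N J := by
  refine ⟨m, hm, fun a ha => ?_⟩
  induction ha with
  | base d hd => exact ⟨m, fun _ _ => rfl, hD ⟨d, hd, rfl⟩⟩
  | fire σ hσ θ h ih =>
    by_cases hy : ∃ y ∈ σ.existVars, .mk σ y (bodyPart σ θ) ∈ N
    · obtain ⟨y, hy, hyN⟩ := hy
      exact hN σ hσ θ h y hy hyN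
    · exact exists_lift_of_shy hS hJ hm hσ h (fun y hy' hyN => hy ⟨y, hy', hyN⟩) ih

theorem covers_empty [Nonempty C] {D : Finset (Atom ar C)} {S : Finset (Rule ar C V)}
    (hS : Shy S) {J : Set (Fact ar C)} (hD : database D ⊆ J) (hJ : ParsimoniouslyClosed S J) :
    Covers D S ∅ J :=
  covers_of_births hS hD hJ (fun _ => .const (Classical.arbitrary C)) (fun _ h => h.elim)
    fun _ _ _ _ _ _ h => h.elim

/-- One resumption buys one more null. Freezing turns the images chosen in `I` into constants,
including one for `ν₀` taken from its birth fact. Since `ν₀` is not recorded by any null of `N`,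
this choice does not disturb the birth facts of the others. -/
theorem Covers.resume [Nonempty C] {D : Finset (Atom ar C)} {S : Finset (Rule ar C V)}
    (hS : Shy S) {I J : Set (Fact ar C)} (hD : database D ⊆ J) (hJ : ParsimoniouslyClosed S J)
    (hIJ : Atom.map GTerm.freeze '' I ⊆ J) {N : Set (ONull ar C V)} (hI : Covers D S N I)
    (ν₀ : ONull ar C V) (hν₀ : ∀ ν ∈ N, ¬ ONull.Older ν₀ ν) :
    Covers D S (insert ν₀ N) J := by
  classical
  obtain ⟨m, -, hI⟩ := hI
  have hfr : ∀ {a : Atom ar (GTerm C (ONull ar C V))} {g : ONull ar C V → GTerm C ℕ},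
      a.map (GTerm.lift g) ∈ I → a.map (GTerm.lift (GTerm.freeze ∘ g)) ∈ J := fun {a g} h => by
    have : a.map (GTerm.lift (GTerm.freeze ∘ g)) = (a.map (GTerm.lift g)).map GTerm.freeze :=
      Atom.map_congr (g := GTerm.freeze ∘ GTerm.lift g) fun i => GTerm.lift_freeze_comp g _
    exact this ▸ hIJ ⟨_, h, rfl⟩
  -- `t` is the frozen image of `ν₀` in its birth fact, or an arbitrary constant if no applicable
  -- firing creates `ν₀`.
  obtain ⟨t, ht, hbirth⟩ : ∃ t : GTerm C ℕ, (∀ k, t ≠ .null k) ∧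
      ∀ σ ∈ S, ∀ θ : V → GTerm C (ONull ar C V),
      (∀ b ∈ σ.body, OChase D S (b.map (Term.subst θ))) → ∀ y, ν₀ = .mk σ y (bodyPart σ θ) →
      ∃ g, g ν₀ = t ∧ Set.EqOn g (GTerm.freeze ∘ m) N ∧
        (σ.head.map (Term.subst (oExtend σ θ))).map (GTerm.lift g) ∈ J := by
    by_cases h : ∃ σ ∈ S, ∃ θ : V → GTerm C (ONull ar C V),
      (∀ b ∈ σ.body, OChase D S (b.map (Term.subst θ))) ∧ ∃ y, ν₀ = .mk σ y (bodyPart σ θ)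
    · obtain ⟨σ, hσ, θ, hθ, y, rfl⟩ := h
      obtain ⟨g, hg, hgI⟩ := hI _ (.fire σ hσ θ hθ)
      refine ⟨_, GTerm.freeze_ne_null (g (.mk σ y (bodyPart σ θ))), ?_⟩
      intro σ' _ θ' _ y' he
      simp only [ONull.mk.injEq] at he
      obtain ⟨rfl, rfl, he⟩ := he
      refine ⟨GTerm.freeze ∘ g, rfl, fun ν hν => congrArg GTerm.freeze (hg hν), ?_⟩
      -- A null determines its rule and the body part of its homomorphism, so every firing creating
      -- `ν₀` yields the same fact.
      rw [← oExtend_eq_of_bodyPart_eq he]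
      exact hfr hgI
    · exact ⟨GTerm.const (Classical.arbitrary C), fun k => nofun,
        fun σ hσ θ hθ y he => absurd ⟨σ, hσ, θ, hθ, y, he⟩ h⟩
  refine covers_of_births hS hD hJ (Function.update (GTerm.freeze ∘ m) ν₀ t) ?_ ?_
  · intro ν _
    by_cases h : ν = ν₀
    · subst h; simpa using ht
    · simpa [h] using GTerm.freeze_ne_null (m ν)
  · intro σ hσ θ h y hy hyN
    -- A firing can create several nulls at once. If `ν₀` is among them, the homomorphism that
    -- defined `t` has to be used.
    by_cases hb : ∃ y', ν₀ = .mk σ y' (bodyPart σ θ)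
    · obtain ⟨y', hy'⟩ := hb
      obtain ⟨g, hgt, hgm, hgJ⟩ := hbirth σ hσ θ h y' hy'
      refine ⟨g, fun ν hν => ?_, hgJ⟩
      by_cases he : ν = ν₀
      · subst he; simpa using hgt
      · simpa [he] using hgm (hν.resolve_left he)
    · have hyN' := hyN.resolve_left fun he => hb ⟨y, he.symm⟩
      have ha : OChase D S (σ.head.map (Term.subst (oExtend σ θ))) := .fire σ hσ θ h
      obtain ⟨g, hg, hgI⟩ := hI _ ha
      -- Here `ν₀` is absent from the generated fact: it is not created by this firing and, by
      -- `hν₀`, not a value of a body variable. Redefining the map at `ν₀` is therefore harmless.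
      refine ⟨Function.update (GTerm.freeze ∘ g) ν₀ t, fun ν hν => ?_, ?_⟩
      · by_cases he : ν = ν₀
        · subst he; simp
        · simpa [he] using congrArg GTerm.freeze (hg (hν.resolve_left he))
      · convert hfr hgI using 1
        rw [Atom.map_subst_map fun _ => rfl, Atom.map_subst_map fun _ => rfl]
        refine Atom.map_subst_congr fun x hx => ?_
        by_cases hxb : x ∈ σ.bodyVars
        · simp only [Function.comp, oExtend_of_mem hxb]
          rcases OChase.const_or_attacked h hxb with ⟨c, hc⟩ | ⟨τ, z, η, hη, -⟩
          · rw [hc]; rfl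
          · have hne : ONull.mk τ z η ≠ ν₀ := by
              rintro rfl
              exact hν₀ _ hyN' (ONull.older_of_body hxb hη y)
            simp [hη, GTerm.lift, hne]
        · have hne : ONull.mk σ x (bodyPart σ θ) ≠ ν₀ := fun he => hb ⟨x, he.symm⟩
          simp [oExtend_of_not_mem hxb, GTerm.lift, hne]

/-! ### Counting nulls along the iterations -/

theorem ONull.exists_newest (N : Finset (ONull ar C V)) (hN : N.Nonempty) :
    ∃ ν₀ ∈ N, ∀ ν ∈ N, ¬ ONull.Older ν₀ ν := by
  have : IsWellFounded (ONull ar C V) ONull.Older := ⟨ONull.older_wf⟩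
  obtain ⟨ν₀, h₀, hmax⟩ := N.exists_max_image (IsWellFounded.rank ONull.Older) hN
  exact ⟨ν₀, h₀, fun ν hν h => (hmax ν hν).not_gt (IsWellFounded.rank_lt_of_rel h)⟩

/-- `IterationChain D S r I`: the set `I` is the last of `r + 1` sets of facts, each of which is
parsimoniously closed and contains the database and the frozen previous set. -/
inductive IterationChain (D : Finset (Atom ar C)) (S : Finset (Rule ar C V)) :
    ℕ → Set (Fact ar C) → Prop where
  | zero (J : Set (Fact ar C)) (hD : database D ⊆ J) (hJ : ParsimoniouslyClosed S J) :
      IterationChain D S 0 J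
  | succ (r : ℕ) (I J : Set (Fact ar C)) (hI : IterationChain D S r I)
      (hIJ : Atom.map GTerm.freeze '' I ⊆ J) (hJ : ParsimoniouslyClosed S J) :
      IterationChain D S (r + 1) J

theorem freeze_map_of_mem_database {D : Finset (Atom ar C)} {a : Fact ar C}
    (ha : a ∈ database D) : a.map GTerm.freeze = a := by
  obtain ⟨d, -, rfl⟩ := ha
  rfl

theorem IterationChain.database_subset {D : Finset (Atom ar C)} {S : Finset (Rule ar C V)} {r : ℕ}
    {I : Set (Fact ar C)} (h : IterationChain D S r I) : database D ⊆ I := by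
  induction h with
  | zero J hD hJ => exact hD
  | succ r I J _ hIJ _ ih =>
    exact fun a ha => hIJ ⟨a, ih ha, freeze_map_of_mem_database ha⟩

/-- The newest null is peeled off at each iteration. The base iteration fixes no null in common,
which explains the shift between `r` and the number `r + 1` of iterations. -/
theorem IterationChain.covers [Nonempty C] {D : Finset (Atom ar C)} {S : Finset (Rule ar C V)}
    (hS : Shy S) {r : ℕ} {I : Set (Fact ar C)} (h : IterationChain D S r I)
    (N : Finset (ONull ar C V)) (hN : N.card ≤ r) : Covers D S ↑N I := by
  classical
  induction h generalizing N with
  | zero J hD hJ =>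
    obtain rfl : N = ∅ := by simpa using hN
    simpa using covers_empty hS hD hJ
  | succ r I J hI hIJ hJ ih =>
    have hD : database D ⊆ J := (IterationChain.succ r I J hI hIJ hJ).database_subset
    rcases N.eq_empty_or_nonempty with rfl | hne
    · simpa using covers_empty hS hD hJ
    · obtain ⟨ν₀, h₀, hmax⟩ := ONull.exists_newest N hne
      have := Covers.resume hS hD hJ hIJ (ih (N.erase ν₀) (by
        rw [Finset.card_erase_of_mem h₀]; omega)) ν₀
        fun ν hν => hmax ν (Finset.mem_of_mem_erase hν)
      rwa [← Finset.coe_insert, Finset.insert_erase h₀] at this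

theorem finite_vars (q : BCQ ar C V) : {x : V | ∃ a ∈ q, a.HasVar x}.Finite := by
  have : {x : V | ∃ a ∈ q, a.HasVar x} = ⋃ a ∈ q, {x | a.HasVar x} := by ext; simp
  rw [this]
  refine q.finite_toSet.biUnion fun a _ => ?_
  refine ((Set.finite_range a.args).preimage (f := Term.var) ?_).subset ?_
  · exact fun _ _ _ _ h => by cases h; rfl
  · exact fun x ⟨i, hi⟩ => ⟨i, hi⟩

theorem IterationChain.entails [Nonempty C] {D : Finset (Atom ar C)} {S : Finset (Rule ar C V)}
    (hS : Shy S) {q : BCQ ar C V} {I : Set (Fact ar C)} (h : IterationChain D S (numVars q) I)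
    (hq : Entails (ochase D S) q) : Entails I q := by
  classical
  obtain ⟨θ, hθ⟩ := hq
  have hW := finite_vars q
  set W := hW.toFinset with hWdef
  have hcard : W.card = numVars q := (Set.ncard_eq_toFinset_card _ hW).symm
  let f : V → Option (ONull ar C V) := fun x => match θ x with
    | .null ν => some ν
    | _ => none
  -- These are the nulls that the query variables take; agreement on them makes the homomorphisms of
  -- the query atoms into one.
  set N : Finset (ONull ar C V) := (W.image f).eraseNone with hNdef
  have hN : N.card ≤ numVars q :=
    (Finset.card_eraseNone_le _).trans (Finset.card_image_le.trans hcard.le)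
  obtain ⟨m, -, hm⟩ := h.covers hS N hN
  refine ⟨fun x => (θ x).lift m, fun a ha => ?_⟩
  obtain ⟨g, hg, hgI⟩ := hm _ (hθ a ha)
  convert hgI using 1
  rw [Atom.map_subst_map fun _ => rfl]
  refine Atom.map_subst_congr fun x hx => ?_
  obtain ⟨i, hi⟩ := id hx
  have harg := OChase.const_or_invaded (hθ a ha) i
  simp only [Atom.map, hi, Term.subst] at harg
  rcases harg with ⟨c, hc⟩ | ⟨τ, y, η, hη, -⟩
  · simp [hc, GTerm.lift]
  · have : ONull.mk τ y η ∈ N := by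
      simp only [hNdef, Finset.mem_eraseNone, Finset.mem_image]
      exact ⟨x, hW.mem_toFinset.2 ⟨a, ha, hx⟩, by simp [f, hη]⟩
    simp only [Function.comp, hη, GTerm.lift]
    exact (hg this).symm

end Completeness

/-! ### Soundness -/

section Soundness

variable {P : Type*} {ar : P → ℕ} {C V : Type*}

/-- The map `h` of labels sends all facts of `I` to facts of the oblivious chase. -/
def MapsToOChase (D : Finset (Atom ar C)) (S : Finset (Rule ar C V))
    (h : ℕ → GTerm C (ONull ar C V)) (I : Set (Fact ar C)) : Prop :=
  ∀ a ∈ I, OChase D S (a.map (GTerm.lift h))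

theorem GTerm.lift_congr {N M : Type*} {h h' : N → GTerm C M} {t : GTerm C N}
    (H : ∀ n, t = .null n ∨ t = .frozen n → h' n = h n) : t.lift h' = t.lift h := by
  cases t with
  | const c => rfl
  | frozen n => exact H n (.inr rfl)
  | null n => exact H n (.inl rfl)

theorem MapsToOChase.congr {D : Finset (Atom ar C)} {S : Finset (Rule ar C V)}
    {h h' : ℕ → GTerm C (ONull ar C V)} {I : Set (Fact ar C)} (hI : MapsToOChase D S h I)
    (H : Set.EqOn h' h (labels I)) : MapsToOChase D S h' I := by
  intro a ha
  have : a.map (GTerm.lift h') = a.map (GTerm.lift h) :=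
    Atom.map_congr fun i => GTerm.lift_congr fun n hn => H ⟨a, ha, i, hn⟩
  exact this ▸ hI a ha

/-- The new labels lie outside `L`, so they can be sent to the nulls that the oblivious chase
creates for the same body homomorphism. Allowing `L` to exceed the labels of `I` lets one map serve
all iterations of the pipeline. -/
theorem MapsToOChase.exists_extension {D : Finset (Atom ar C)} {S : Finset (Rule ar C V)}
    {h : ℕ → GTerm C (ONull ar C V)} {I : Set (Fact ar C)} (hI : MapsToOChase D S h I)
    {L : Set ℕ} (hL : labels I ⊆ L) {σ : Rule ar C V} (hσ : σ ∈ S) {θ : V → GTerm C ℕ}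
    (hθ : Applicable σ θ I) (hfresh : FreshOn σ θ L) :
    ∃ h', Set.EqOn h' h L ∧ OChase D S ((σ.head.map (Term.subst θ)).map (GTerm.lift h')) := by
  classical
  have hH : ∀ n, ∃ t, (n ∈ L → t = h n) ∧
      ∀ y ∈ σ.existVars, θ y = .null n → t = oExtend σ (GTerm.lift h ∘ θ) y := by
    intro n
    by_cases hn : ∃ y ∈ σ.existVars, θ y = .null n
    · obtain ⟨y, hy, hyn⟩ := hn
      refine ⟨oExtend σ (GTerm.lift h ∘ θ) y, fun hnL => ?_, fun z hz hzn => ?_⟩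
      · obtain ⟨n', hn', hyn'⟩ := hfresh.1 y hy
        rw [hyn] at hyn'
        cases hyn'
        exact absurd hnL hn'
      · rw [hfresh.2 hy hz (hyn.trans hzn.symm)]
    · exact ⟨h n, fun _ => rfl, fun y hy hyn => absurd ⟨y, hy, hyn⟩ hn⟩
  choose h' hh' hnew using hH
  refine ⟨h', fun n hn => hh' n hn, ?_⟩
  have : (σ.head.map (Term.subst θ)).map (GTerm.lift h') =
      σ.head.map (Term.subst (oExtend σ (GTerm.lift h ∘ θ))) := by
    rw [Atom.map_subst_map fun _ => rfl]
    refine Atom.map_subst_congr fun x hx => ?_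
    by_cases hxb : x ∈ σ.bodyVars
    · rw [oExtend_of_mem hxb]
      obtain ⟨b, hb, j, hj⟩ := hxb
      exact GTerm.lift_congr fun n hn =>
        hh' n (hL ⟨_, hθ b hb, j, by simpa only [Atom.map, hj, Term.subst] using hn⟩)
    · obtain ⟨n, -, hn⟩ := hfresh.1 x ⟨hx, hxb⟩
      rw [← hnew n x ⟨hx, hxb⟩ hn]
      simp [hn, GTerm.lift]
  rw [this]
  refine .fire σ hσ _ fun b hb => ?_
  rw [← Atom.map_subst_map fun _ => rfl]
  exact hI _ (hθ b hb)

theorem mapsToOChase_freeze {D : Finset (Atom ar C)} {S : Finset (Rule ar C V)}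
    {h : ℕ → GTerm C (ONull ar C V)} {a : Fact ar C} (ha : OChase D S (a.map (GTerm.lift h))) :
    OChase D S ((a.map GTerm.freeze).map (GTerm.lift h)) := by
  have : (a.map GTerm.freeze).map (GTerm.lift h) = a.map (GTerm.lift h) :=
    Atom.map_congr (f := GTerm.lift h ∘ GTerm.freeze) (g := GTerm.lift h) (a := a)
      fun i => by cases a.args i <;> rfl
  rwa [this]

theorem mapsToOChase_database (D : Finset (Atom ar C)) (S : Finset (Rule ar C V))
    (h : ℕ → GTerm C (ONull ar C V)) : MapsToOChase D S h (database D) := by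
  rintro _ ⟨d, hd, rfl⟩
  exact .base d hd

theorem MapsToOChase.entails {D : Finset (Atom ar C)} {S : Finset (Rule ar C V)}
    {h : ℕ → GTerm C (ONull ar C V)} {I : Set (Fact ar C)} (hI : MapsToOChase D S h I)
    {q : BCQ ar C V} (hq : Entails I q) : Entails (ochase D S) q := by
  obtain ⟨θ, hθ⟩ := hq
  refine ⟨GTerm.lift h ∘ θ, fun a ha => ?_⟩
  rw [← Atom.map_subst_map fun _ => rfl]
  exact hI _ (hθ a ha)

end Soundness

/-! ### Fresh nulls and closed sets -/

section Fresh

variable {P : Type*} {ar : P → ℕ} {C V : Type*}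

theorem finite_database (D : Finset (Atom ar C)) : (database D : Set (Fact ar C)).Finite := by
  refine (D.finite_toSet.image (Atom.map GTerm.const)).subset ?_
  rintro _ ⟨d, hd, rfl⟩
  exact ⟨d, hd, rfl⟩

theorem finite_labels {I : Set (Fact ar C)} (hI : I.Finite) : (labels I).Finite := by
  have hT : (⋃ a ∈ I, Set.range a.args).Finite := hI.biUnion fun a _ => Set.finite_range _
  have h₁ : Function.Injective (GTerm.null (C := C) (N := ℕ)) := fun _ _ h => by cases h; rfl
  have h₂ : Function.Injective (GTerm.frozen (C := C) (N := ℕ)) := fun _ _ h => by cases h; rfl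
  refine ((hT.preimage h₁.injOn).union (hT.preimage h₂.injOn)).subset ?_
  rintro n ⟨a, ha, i, hn | hn⟩
  · exact .inl (Set.mem_biUnion ha ⟨i, hn⟩)
  · exact .inr (Set.mem_biUnion ha ⟨i, hn⟩)

theorem exists_freshOn (σ : Rule ar C V) (θ : V → GTerm C ℕ) {L : Set ℕ} (hL : L.Finite) :
    ∃ θ', (∀ x ∈ σ.bodyVars, θ' x = θ x) ∧ FreshOn σ θ' L := by
  classical
  obtain ⟨B, hB⟩ := hL.bddAbove
  have hpos : ∀ y, ∃ k : ℕ, y ∈ σ.existVars → ∃ i, i.val = k ∧ σ.head.args i = .var y := by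
    intro y
    by_cases hy : y ∈ σ.existVars
    · obtain ⟨i, hi⟩ := hy.1
      exact ⟨i, fun _ => ⟨i, rfl, hi⟩⟩
    · exact ⟨0, fun h => absurd h hy⟩
  choose k hk using hpos
  -- Labels above the bound `B` of `L` are fresh; offsetting by a head position of the variable
  -- makes them distinct.
  refine ⟨fun x => if x ∈ σ.bodyVars then θ x else .null (B + 1 + k x), fun x hx => by simp [hx],
    fun y hy => ⟨B + 1 + k y, fun hn => ?_, by simp [hy.2]⟩, fun y hy z hz h => ?_⟩
  · have := hB hn
    omega
  · simp only [hy.2, hz.2, if_false, GTerm.null.injEq, Nat.add_left_cancel_iff] at h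
    obtain ⟨i, hi, hiy⟩ := hk y hy
    obtain ⟨j, hj, hjz⟩ := hk z hz
    obtain rfl : i = j := Fin.ext (by omega)
    rw [hiy] at hjz
    cases hjz
    rfl

theorem Applicable.congr {σ : Rule ar C V} {θ θ' : V → GTerm C ℕ} {I : Set (Fact ar C)}
    (h : Applicable σ θ I) (H : ∀ x ∈ σ.bodyVars, θ' x = θ x) : Applicable σ θ' I := by
  intro b hb
  rw [Atom.map_subst_congr fun x hx => H x ⟨b, hb, hx⟩]
  exact h b hb

/-- Any applicable homomorphism can be given fresh values at the existential variables without
changing the body; the homomorphism that blocks its firing is the required one. -/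
theorem parsimoniouslyClosed_of_blocked {S : Finset (Rule ar C V)} {J : Set (Fact ar C)}
    {L : Set ℕ} (hL : L.Finite)
    (h : ∀ σ ∈ S, ∀ θ, Applicable σ θ J → FreshOn σ θ L →
      ¬ HomomorphismCheck J (σ.head.map (Term.subst θ))) : ParsimoniouslyClosed S J := by
  intro σ hσ θ hθ
  obtain ⟨θ', hθ', hfresh⟩ := exists_freshOn σ θ hL
  obtain ⟨g, hg, hgJ⟩ := not_not.1 (h σ hσ θ' (hθ.congr hθ') hfresh)
  refine ⟨g, hg, g ∘ θ', fun x hx => congrArg g (hθ' x hx), ?_⟩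
  rwa [← Atom.map_subst_map hg.1]

theorem HomomorphismCheck.not_mem {I : Set (Fact ar C)} {a : Fact ar C}
    (h : HomomorphismCheck I a) : a ∉ I :=
  fun ha => h ⟨id, ⟨fun _ => rfl, fun _ => rfl⟩, ha⟩

end Fresh

/-! ### Finiteness -/

section Finiteness

variable {P : Type*} {ar : P → ℕ} {C V : Type*}

/-- The term itself if it is not a null. -/
def GTerm.rigid : GTerm C ℕ → Option (GTerm C ℕ)
  | .null _ => none
  | t => some t

/-- The predicate, the terms that homomorphisms fix, and the equalities between the terms of a
fact. -/
def Atom.pattern (a : Fact ar C) :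
    (p : P) × ((Fin (ar p) → Option (GTerm C ℕ)) × (Fin (ar p) → Fin (ar p) → Prop)) :=
  ⟨a.pred, fun i => (a.args i).rigid, fun i j => a.args i = a.args j⟩

/-- Terms that are not nulls agree, and the equalities recorded in the pattern make it consistent to
send each null of `b` to the term of `a` at the same position. -/
theorem exists_isHom_of_pattern_eq {a b : Fact ar C} (h : a.pattern = b.pattern) :
    ∃ g, IsHom g ∧ b.map g = a := by
  classical
  obtain ⟨p, u⟩ := a
  obtain ⟨p', v⟩ := b
  simp only [Atom.pattern, Sigma.mk.injEq] at h
  obtain ⟨rfl, h⟩ := h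
  simp only [heq_eq_eq, Prod.mk.injEq] at h
  obtain ⟨hr, he⟩ := h
  replace hr : ∀ i, (u i).rigid = (v i).rigid := congrFun hr
  replace he : ∀ i j, (u i = u j) = (v i = v j) := fun i j => congrFun (congrFun he i) j
  have hG : ∀ n : ℕ, ∃ t : GTerm C ℕ, ∀ i, v i = .null n → t = u i := by
    intro n
    by_cases hn : ∃ i, v i = .null n
    · obtain ⟨i, hi⟩ := hn
      exact ⟨u i, fun j hj => (he i j).mpr (hi.trans hj.symm)⟩
    · exact ⟨.null n, fun i hi => absurd ⟨i, hi⟩ hn⟩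
  choose G hG using hG
  refine ⟨fun t => match t with
    | .null n => G n
    | t => t, ⟨fun _ => rfl, fun _ => rfl⟩, ?_⟩
  simp only [Atom.map, Atom.mk.injEq, heq_eq_eq, true_and]
  funext i
  have hri := hr i
  cases hv : v i with
  | null n => exact hG n i hv
  | const c =>
    rw [hv] at hri
    cases hu : u i <;> rw [hu] at hri <;> simp [GTerm.rigid] at hri ⊢
    exact hri.symm
  | frozen n =>
    rw [hv] at hri
    cases hu : u i <;> rw [hu] at hri <;> simp [GTerm.rigid] at hri ⊢
    exact hri.symm

theorem finite_patterns {Q : Set P} (hQ : Q.Finite) {K : Set (GTerm C ℕ)} (hK : K.Finite) :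
    {π | ∃ a : Fact ar C, a.pred ∈ Q ∧ (∀ i, (∃ k, a.args i = .null k) ∨ a.args i ∈ K) ∧
      a.pattern = π}.Finite := by
  have hK' : (insert none (some '' K)).Finite := (hK.image some).insert none
  refine (hQ.biUnion (t := fun p => Sigma.mk p ''
    ((Set.univ.pi fun _ : Fin (ar p) => insert none (some '' K)) ×ˢ
      (Set.univ : Set (Fin (ar p) → Fin (ar p) → Prop)))) fun p _ =>
    ((Set.Finite.pi' fun _ => hK').subset (by simp [Set.pi]) |>.prod Set.finite_univ).image
      _).subset ?_
  rintro _ ⟨a, hp, ha, rfl⟩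
  refine Set.mem_biUnion hp ⟨_, ⟨fun i _ => ?_, trivial⟩, rfl⟩
  rcases ha i with ⟨k, hk⟩ | hK
  · simp [hk, GTerm.rigid]
  · cases hi : a.args i with
    | null k => simp [GTerm.rigid, hi]
    | const c => exact .inr ⟨_, hi ▸ hK, by simp [hi, GTerm.rigid]⟩
    | frozen n => exact .inr ⟨_, hi ▸ hK, by simp [hi, GTerm.rigid]⟩

/-- Only finitely many facts can be fired, in an infinite sequence of steps too, if the other facts
added to the sequence stem from a finite set. -/
theorem finite_iUnion_of_fire (S : Finset (Rule ar C V)) {B : Set (Fact ar C)} (hB : B.Finite)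
    (f : ℕ → Set (Fact ar C)) (h0 : f 0 ⊆ B)
    (hstep : ∀ k, f (k + 1) = f k ∨ (∃ a ∈ B, f (k + 1) = insert a (f k)) ∨
      ∃ σ ∈ S, ∃ θ : V → GTerm C ℕ, Applicable σ θ (f k) ∧
        (∀ y ∈ σ.existVars, ∃ n, θ y = .null n) ∧
        HomomorphismCheck (f k) (σ.head.map (Term.subst θ)) ∧
        f (k + 1) = insert (σ.head.map (Term.subst θ)) (f k)) :
    (⋃ k, f k).Finite := by
  classical
  -- All terms other than nulls stem from `B` or are constants of rule heads; `.null 0` is a dummy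
  -- for the head variables.
  set K : Set (GTerm C ℕ) := (⋃ a ∈ B, Set.range a.args) ∪
    ⋃ σ ∈ S, Set.range fun i => (σ.head.args i).subst fun _ => .null 0 with hKdef
  have hK : K.Finite := (hB.biUnion fun a _ => Set.finite_range _).union
    (S.finite_toSet.biUnion fun σ _ => Set.finite_range _)
  have hfire : ∀ k, (∀ a ∈ f k, ∀ i, (∃ n, a.args i = .null n) ∨ a.args i ∈ K) →
      ∀ σ ∈ S, ∀ θ : V → GTerm C ℕ, Applicable σ θ (f k) →
        (∀ y ∈ σ.existVars, ∃ n, θ y = .null n) → ∀ i : Fin (ar σ.head.pred),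
        (∃ n, (σ.head.args i).subst θ = .null n) ∨ (σ.head.args i).subst θ ∈ K := by
    intro k ih σ hσ θ hθ hy i
    cases hi : σ.head.args i with
    | const c =>
      refine .inr (.inr (Set.mem_biUnion hσ ⟨i, ?_⟩))
      simp [hi, Term.subst]
    | var x =>
      by_cases hx : x ∈ σ.bodyVars
      · obtain ⟨b, hb, j, hj⟩ := hx
        have := ih _ (hθ b hb) j
        simpa only [Atom.map, hj, Term.subst] using this
      · exact .inl (hy x (Rule.mem_existVars_of_not_mem hi hx))
  have hBK : ∀ a ∈ B, ∀ i, a.args i ∈ K := fun a ha i => .inl (Set.mem_biUnion ha ⟨i, rfl⟩)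
  have hterms : ∀ k, ∀ a ∈ f k, ∀ i, (∃ n, a.args i = .null n) ∨ a.args i ∈ K := by
    intro k
    induction k with
    | zero => exact fun a ha i => .inr (hBK a (h0 ha) i)
    | succ k ih =>
      rcases hstep k with h | ⟨a, ha, h⟩ | ⟨σ, hσ, θ, hθ, hy, -, h⟩ <;> rw [h]
      · exact ih
      · rintro b (rfl | hb)
        · exact fun i => .inr (hBK b ha i)
        · exact ih b hb
      · rintro b (rfl | hb)
        · exact hfire k ih σ hσ θ hθ hy
        · exact ih b hb
  have hbirth : ∀ a ∈ (⋃ k, f k) \ B, ∃ k, a ∈ f (k + 1) ∧ HomomorphismCheck (f k) a ∧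
      a.pred ∈ (fun σ : Rule ar C V => σ.head.pred) '' S := by
    rintro a ⟨ha, haB⟩
    have hex : ∃ k, a ∈ f k := Set.mem_iUnion.1 ha
    obtain ⟨k, hk⟩ : ∃ k, Nat.find hex = k + 1 :=
      Nat.exists_eq_succ_of_ne_zero fun h => haB (h0 (h ▸ Nat.find_spec hex))
    have hak : a ∈ f (k + 1) := hk ▸ Nat.find_spec hex
    have hnk : a ∉ f k := Nat.find_min hex (by omega)
    refine ⟨k, hak, ?_⟩
    rcases hstep k with h | ⟨b, hb, h⟩ | ⟨σ, hσ, θ, -, -, hc, h⟩ <;> rw [h] at hak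
    · exact absurd hak hnk
    · rcases hak with rfl | hak
      · exact absurd hb haB
      · exact absurd hak hnk
    · rcases hak with rfl | hak
      · exact ⟨hc, σ, hσ, rfl⟩
      · exact absurd hak hnk
  have hmono : Monotone f := monotone_nat_of_le_succ fun k => by
    rcases hstep k with h | ⟨b, -, h⟩ | ⟨σ, -, θ, -, -, -, h⟩ <;> rw [h]
    · exact Set.subset_insert _ _
    · exact Set.subset_insert _ _
  have hfin : ((⋃ k, f k) \ B).Finite := by
    refine Set.Finite.of_injOn (f := Atom.pattern) ?_ ?_
      (finite_patterns (S.finite_toSet.image fun σ : Rule ar C V => σ.head.pred) hK)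
    · intro a ha
      obtain ⟨k, hk, -, hp⟩ := hbirth a ha
      exact ⟨a, hp, hterms _ a hk, rfl⟩
    -- Of two fired facts with one pattern, the later would map onto the earlier, against the firing
    -- condition. So both appear in the same step, which adds a single fact.
    · have key : ∀ a b k l, a ∈ f (k + 1) → HomomorphismCheck (f k) a → b ∈ f (l + 1) →
          HomomorphismCheck (f l) b → a.pattern = b.pattern → ¬ k < l := by
        intro a b k l hak _ _ hcb hab hkl
        obtain ⟨g, hg, hga⟩ := exists_isHom_of_pattern_eq hab
        exact hcb ⟨g, hg, hga ▸ hmono hkl hak⟩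
      intro a ha b hb hab
      obtain ⟨k, hk, hck, -⟩ := hbirth a ha
      obtain ⟨l, hl, hcl, -⟩ := hbirth b hb
      obtain rfl : k = l := le_antisymm
        (not_lt.1 (key b a l k hl hcl hk hck hab.symm)) (not_lt.1 (key a b k l hk hck hl hcl hab))
      have hak := hck.not_mem
      have hbk := hcl.not_mem
      rcases hstep k with h | ⟨c, -, h⟩ | ⟨σ, -, θ, -, -, -, h⟩ <;> rw [h] at hk hl
      · exact absurd hk hak
      · rw [hk.resolve_right hak, hl.resolve_right hbk]
      · rw [hk.resolve_right hak, hl.resolve_right hbk]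
  exact (hfin.union hB).subset fun a ha => by
    by_cases haB : a ∈ B
    · exact .inr haB
    · exact .inl ⟨ha, haB⟩

theorem not_finite_iUnion_of_ssubset {α : Type*} (f : ℕ → Set α) (h : ∀ k, f k ⊂ f (k + 1)) :
    ¬ (⋃ k, f k).Finite := fun hfin =>
  Set.infinite_range_of_injective (strictMono_nat_of_lt_succ h).injective
    (hfin.finite_subsets.subset (by rintro _ ⟨k, rfl⟩; exact Set.subset_iUnion f k))

theorem exists_terminal {α : Type*} (R : α → α → Prop) (x : α)
    (h : ¬ ∃ run : ℕ → α, run 0 = x ∧ ∀ k, R (run k) (run (k + 1))) :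
    ∃ y, Relation.ReflTransGen R x y ∧ ∀ z, ¬ R y z := by
  by_contra! hne
  choose! next hnext using hne
  have hreach : ∀ k, Relation.ReflTransGen R x (next^[k] x) := by
    intro k
    induction k with
    | zero => exact .refl
    | succ k ih => rw [Function.iterate_succ_apply']; exact ih.tail (hnext _ ih)
  exact h ⟨fun k => next^[k] x, rfl, fun k => by
    simp only [Function.iterate_succ_apply']; exact hnext _ (hreach k)⟩

end Finiteness

/-! ### The parsimonious chase with resumption -/

section PChase

variable {P : Type*} {ar : P → ℕ} {C V : Type*}

theorem exists_isPChase (S : Finset (Rule ar C V)) {I : Set (Fact ar C)} (hI : I.Finite) :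
    ∃ J, IsPChase I S J := by
  refine exists_terminal (PStep S) I ?_
  rintro ⟨run, h0, hrun⟩
  refine not_finite_iUnion_of_ssubset run (fun k => ?_)
    (finite_iUnion_of_fire S hI run h0.le fun k => ?_)
  · obtain ⟨σ, -, θ, -, -, hc, h⟩ := hrun k
    rw [h]
    exact Set.ssubset_insert hc.not_mem
  · obtain ⟨σ, hσ, θ, hθ, hf, hc, h⟩ := hrun k
    exact .inr (.inr ⟨σ, hσ, θ, hθ, fun y hy => (hf.1 y hy).imp fun n hn => hn.2, hc, h⟩)

theorem IsPChase.subset {S : Finset (Rule ar C V)} {I J : Set (Fact ar C)} (h : IsPChase I S J) :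
    I ⊆ J := by
  obtain ⟨h, -⟩ := h
  induction h with
  | refl => exact subset_rfl
  | tail _ hs ih =>
    obtain ⟨σ, -, θ, -, -, -, rfl⟩ := hs
    exact ih.trans (Set.subset_insert _ _)

theorem IsPChase.finite {S : Finset (Rule ar C V)} {I J : Set (Fact ar C)} (h : IsPChase I S J)
    (hI : I.Finite) : J.Finite := by
  obtain ⟨h, -⟩ := h
  induction h with
  | refl => exact hI
  | tail _ hs ih =>
    obtain ⟨σ, -, θ, -, -, -, rfl⟩ := hs
    exact ih.insert _

theorem IsPChase.parsimoniouslyClosed {S : Finset (Rule ar C V)} {I J : Set (Fact ar C)}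
    (h : IsPChase I S J) (hI : I.Finite) : ParsimoniouslyClosed S J :=
  parsimoniouslyClosed_of_blocked (finite_labels (h.finite hI)) fun σ hσ θ hθ hf hc =>
    h.2 _ ⟨σ, hσ, θ, hθ, hf, hc, rfl⟩

theorem IsPChase.exists_mapsToOChase {D : Finset (Atom ar C)} {S : Finset (Rule ar C V)}
    {I J : Set (Fact ar C)} (h : IsPChase I S J) (hI : ∃ h, MapsToOChase D S h I) :
    ∃ h, MapsToOChase D S h J := by
  obtain ⟨h, -⟩ := h
  induction h with
  | refl => exact hI
  | tail _ hs ih =>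
    obtain ⟨σ, hσ, θ, hθ, hf, -, rfl⟩ := hs
    obtain ⟨h, hh⟩ := ih
    obtain ⟨h', hh', ha⟩ := hh.exists_extension subset_rfl hσ hθ hf
    refine ⟨h', ?_⟩
    rintro b (rfl | hb)
    · exact ha
    · exact hh.congr hh' b hb

theorem IsPChaseR.finite {D : Finset (Atom ar C)} {S : Finset (Rule ar C V)} {r : ℕ}
    {I : Set (Fact ar C)} (h : IsPChaseR D S r I) : I.Finite := by
  induction h with
  | zero => exact finite_database D
  | succ r I J _ hJ ih => exact hJ.finite (ih.image _)

theorem exists_isPChaseR (D : Finset (Atom ar C)) (S : Finset (Rule ar C V)) (r : ℕ) :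
    ∃ I, IsPChaseR D S r I := by
  induction r with
  | zero => exact ⟨_, .zero⟩
  | succ r ih =>
    obtain ⟨I, hI⟩ := ih
    obtain ⟨J, hJ⟩ := exists_isPChase S (hI.finite.image (Atom.map GTerm.freeze))
    exact ⟨J, .succ r I J hI hJ⟩

theorem IsPChaseR.exists_mapsToOChase {D : Finset (Atom ar C)} {S : Finset (Rule ar C V)} {r : ℕ}
    {I : Set (Fact ar C)} [Nonempty C] (h : IsPChaseR D S r I) : ∃ h, MapsToOChase D S h I := by
  induction h with
  | zero => exact ⟨fun _ => .const (Classical.arbitrary C), mapsToOChase_database D S _⟩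
  | succ r I J _ hJ ih =>
    obtain ⟨h, hh⟩ := ih
    refine hJ.exists_mapsToOChase ⟨h, ?_⟩
    rintro _ ⟨a, ha, rfl⟩
    exact mapsToOChase_freeze (hh a ha)

theorem IsPChaseR.iterationChain {D : Finset (Atom ar C)} {S : Finset (Rule ar C V)} {r : ℕ}
    {J : Set (Fact ar C)} (h : IsPChaseR D S (r + 1) J) : IterationChain D S r J := by
  induction r generalizing J with
  | zero =>
    cases h with
    | succ _ I _ hI hJ =>
      cases hI
      exact .zero J (fun a ha => hJ.subset ⟨a, ha, freeze_map_of_mem_database ha⟩)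
        (hJ.parsimoniouslyClosed ((finite_database D).image _))
  | succ r ih =>
    cases h with
    | succ _ I _ hI hJ =>
      exact .succ r I J (ih hI) hJ.subset (hJ.parsimoniouslyClosed (hI.finite.image _))

end PChase

/-! ### The streaming chase -/

section AggregateTrees

variable {P : Type*} {ar : P → ℕ} {C : Type*}

/-- The aggregate fact trees of a set of facts. -/
def aggregateTrees (I : Set (Fact ar C)) (p : P) : AFTree C :=
  {l | ∃ a ∈ I, a.pred = p ∧ l <+: List.ofFn a.args}

/-- All tuples of a predicate have the same length: a full tuple is never extended, and a proper
prefix always is. -/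
theorem isLeaf_aggregateTrees {I : Set (Fact ar C)} {p : P} {t : List (GTerm C ℕ)} :
    AFTree.IsLeaf (aggregateTrees I p) t ↔ ∃ a ∈ I, a.pred = p ∧ t = List.ofFn a.args := by
  constructor
  · rintro ⟨⟨a, ha, hp, s, hs⟩, hleaf⟩
    cases s with
    | nil => exact ⟨a, ha, hp, by simpa using hs⟩
    | cons x s => exact absurd ⟨a, ha, hp, s, by simpa using hs⟩ (hleaf x)
  · rintro ⟨a, ha, rfl, rfl⟩
    refine ⟨⟨a, ha, rfl, List.prefix_rfl⟩, ?_⟩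
    rintro x ⟨b, -, hb, hpre⟩
    have := hpre.length_le
    simp [hb] at this

theorem homomorphismCheckS_iff (I : Set (Fact ar C)) (a : Fact ar C) :
    HomomorphismCheckS (aggregateTrees I) a ↔ HomomorphismCheck I a := by
  refine not_congr (exists_congr fun g => and_congr_right fun _ => ?_)
  simp only [isLeaf_aggregateTrees, List.map_ofFn]
  constructor
  · rintro ⟨t, ⟨⟨p, u⟩, hb, hp, rfl⟩, h⟩
    simp only at hp
    subst hp
    have h' := List.ofFn_injective h
    simp only at h'
    rw [← h'] at hb
    exact hb
  · exact fun h => ⟨_, ⟨_, h, rfl, rfl⟩, rfl⟩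

end AggregateTrees

/-! ### Invariants, termination and final states of the pipeline -/

section Pipeline

variable {P : Type*} {ar : P → ℕ} {C V : Type*}

/-- Properties of all states that the streaming chase reaches. -/
structure State.Valid (D : Finset (Atom ar C)) (S : Finset (Rule ar C V)) (maxRes : ℕ)
    (s : State ar C V) : Prop where
  finite : ∀ i, (s.facts i).Finite
  range : ∀ i, ∀ a ∈ s.facts i, 1 ≤ i ∧ i ≤ maxRes
  trees_eq : ∀ i, s.trees i = aggregateTrees (s.facts i)
  pulled_subset : ∀ i σ, s.pulled i σ ⊆ s.facts i
  mem_of_pulled : ∀ i σ, ∀ a ∈ s.pulled i σ, σ ∈ S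
  database_subset : database D ⊆ s.facts 1
  sound : ∃ h, ∀ i, MapsToOChase D S h (s.facts i)

theorem State.facts_emit_self (s : State ar C V) (i : ℕ) (a : Fact ar C) :
    (s.emit i a).facts i = insert a (s.facts i) := by
  ext b
  simp [State.emit, or_comm]

theorem State.facts_emit_of_ne (s : State ar C V) {i j : ℕ} (h : j ≠ i) (a : Fact ar C) :
    (s.emit i a).facts j = s.facts j := by
  ext b
  simp [State.emit, h]

variable {D : Finset (Atom ar C)} {S : Finset (Rule ar C V)} {maxRes : ℕ}

theorem State.valid_init [Nonempty C] (h : 1 ≤ maxRes) :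
    (State.init D : State ar C V).Valid D S maxRes where
  finite i := (finite_database D).subset fun a ha => ha.2
  range i a ha := by obtain ⟨rfl, -⟩ := ha; exact ⟨le_rfl, h⟩
  trees_eq i := by
    funext p
    ext l
    constructor
    · rintro ⟨hi, a, ha, hp, hl⟩
      exact ⟨a, ⟨hi, ha⟩, hp, hl⟩
    · rintro ⟨a, ⟨hi, ha⟩, hp, hl⟩
      exact ⟨hi, a, ha, hp, hl⟩
  pulled_subset i σ a ha := ha.elim
  mem_of_pulled i σ a ha := ha.elim
  database_subset a ha := ⟨rfl, ha⟩
  sound := ⟨fun _ => .const (Classical.arbitrary C),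
    fun i a ha => mapsToOChase_database D S _ a ha.2⟩

theorem State.Valid.emit {s : State ar C V} (hs : s.Valid D S maxRes) {i : ℕ}
    (hi : 1 ≤ i ∧ i ≤ maxRes) {a : Fact ar C} {h : ℕ → GTerm C (ONull ar C V)}
    (hh : ∀ j, MapsToOChase D S h (s.facts j)) (ha : OChase D S (a.map (GTerm.lift h))) :
    (s.emit i a).Valid D S maxRes where
  finite j := by
    by_cases hj : j = i
    · subst hj; rw [State.facts_emit_self]; exact (hs.finite _).insert a
    · rw [State.facts_emit_of_ne s hj]; exact hs.finite j
  range j b hb := by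
    rcases hb with hb | ⟨rfl, -⟩
    · exact hs.range j b hb
    · exact hi
  trees_eq j := by
    funext p
    ext l
    change (l ∈ s.trees j p ∨ _) ↔ _
    rw [hs.trees_eq]
    constructor
    · rintro (⟨b, hb, hp, hl⟩ | ⟨hj, hp, hl⟩)
      · exact ⟨b, .inl hb, hp, hl⟩
      · exact ⟨a, .inr ⟨hj, rfl⟩, hp.symm, hl⟩
    · rintro ⟨b, hb | ⟨hj, rfl⟩, hp, hl⟩
      · exact .inl ⟨b, hb, hp, hl⟩
      · exact .inr ⟨hj, hp.symm, hl⟩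
  pulled_subset j σ b hb := .inl (hs.pulled_subset j σ hb)
  mem_of_pulled := hs.mem_of_pulled
  database_subset b hb := .inl (hs.database_subset hb)
  sound := by
    refine ⟨h, fun j b hb => ?_⟩
    rcases hb with hb | ⟨-, rfl⟩
    · exact hh j b hb
    · exact ha

theorem State.Valid.step {s s' : State ar C V} (hs : s.Valid D S maxRes)
    (h : SStep S HomomorphismCheckS maxRes s s') : s'.Valid D S maxRes := by
  cases h with
  | pull i σ hσ a ha hp hn =>
    refine ⟨hs.finite, hs.range, hs.trees_eq, ?_, ?_, hs.database_subset, hs.sound⟩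
    · rintro j τ b (hb | ⟨rfl, rfl, rfl⟩)
      · exact hs.pulled_subset j τ hb
      · exact ha
    · rintro j τ b (hb | ⟨rfl, rfl, rfl⟩)
      · exact hs.mem_of_pulled j τ b hb
      · exact hσ
  | fire i σ hσ θ hi hθ hfresh hF =>
    obtain ⟨h, hh⟩ := hs.sound
    have hlab : ∀ j, StreamingChase.labels (s.facts j) ⊆ s.labels := fun j n hn => ⟨j, hn⟩
    obtain ⟨h', hh', ha⟩ := (hh i).exists_extension (hlab i) hσ
      (fun b hb => hs.pulled_subset i σ (hθ b hb)) hfresh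
    exact hs.emit hi (fun j => (hh j).congr (hh'.mono (hlab j))) ha
  | resume i hi a ha hn =>
    obtain ⟨h, hh⟩ := hs.sound
    exact hs.emit ⟨by omega, hi.2⟩ hh (mapsToOChase_freeze (hh i a ha))

theorem State.Valid.homomorphismCheck {s : State ar C V} (hs : s.Valid D S maxRes) {i : ℕ}
    {a : Fact ar C} : HomomorphismCheckS (s.trees i) a ↔ HomomorphismCheck (s.facts i) a := by
  rw [hs.trees_eq, homomorphismCheckS_iff]

theorem State.Valid.finite_labels {s : State ar C V} (hs : s.Valid D S maxRes) :
    s.labels.Finite := by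
  refine ((Set.finite_Iic maxRes).biUnion fun i _ =>
    StreamingChase.finite_labels (hs.finite i)).subset ?_
  rintro n ⟨i, hn⟩
  obtain ⟨a, ha, -⟩ := id hn
  exact Set.mem_biUnion (hs.range i a ha).2 hn

theorem State.valid_of_reachable [Nonempty C] (h : 1 ≤ maxRes) {s : State ar C V}
    (hr : Relation.ReflTransGen (SStep S HomomorphismCheckS maxRes) (State.init D) s) :
    s.Valid D S maxRes := by
  induction hr with
  | refl => exact State.valid_init h
  | tail _ hs ih => exact ih.step hs

/-- The facts of all iterations and the facts pulled by all nodes. -/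
def State.total (s : State ar C V) : Set (ℕ × Option (Rule ar C V) × Fact ar C) :=
  {x | match x.2.1 with
    | none => x.2.2 ∈ s.facts x.1
    | some σ => x.2.2 ∈ s.pulled x.1 σ}

theorem State.total_ssubset_emit {s : State ar C V} {i : ℕ} {a : Fact ar C} (h : a ∉ s.facts i) :
    s.total ⊂ (s.emit i a).total := by
  refine ⟨?_, fun hsub => h (hsub (a := (i, none, a)) (.inr ⟨rfl, rfl⟩))⟩
  rintro ⟨j, _ | σ, b⟩ hb
  · exact .inl hb
  · exact hb

theorem State.total_ssubset_pull {s : State ar C V} {i : ℕ} {σ : Rule ar C V} {a : Fact ar C}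
    (h : a ∉ s.pulled i σ) : s.total ⊂ (s.pull i σ a).total := by
  refine ⟨?_, fun hsub => h (hsub (a := (i, some σ, a)) (.inr ⟨rfl, rfl, rfl⟩))⟩
  rintro ⟨j, _ | τ, b⟩ hb
  · exact hb
  · exact .inl hb

theorem State.Valid.total_ssubset {s s' : State ar C V} (hs : s.Valid D S maxRes)
    (h : SStep S HomomorphismCheckS maxRes s s') : s.total ⊂ s'.total := by
  cases h with
  | pull i σ hσ a ha hp hn => exact State.total_ssubset_pull hn
  | fire i σ hσ θ hi hθ hfresh hF =>
    exact State.total_ssubset_emit (hs.homomorphismCheck.1 hF).not_mem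
  | resume i hi a ha hn => exact State.total_ssubset_emit hn

/-- Iterations may interleave, but over the whole run those facts resumed into one iteration are
frozen copies of facts of the previous one. Induction on the iteration thus provides the finite set
from which facts enter without a firing check. -/
theorem finite_iUnion_facts {run : ℕ → State ar C V} (h0 : run 0 = State.init D)
    (hrun : ∀ k, SStep S HomomorphismCheckS maxRes (run k) (run (k + 1)))
    (hvalid : ∀ k, (run k).Valid D S maxRes) (i : ℕ) : (⋃ k, (run k).facts i).Finite := by
  have main : ∀ (i : ℕ) (B : Set (Fact ar C)) (_ : B.Finite) (_ : database D ⊆ B),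
      (∀ j, j + 1 = i → ∀ k, ∀ a ∈ (run k).facts j, a.map GTerm.freeze ∈ B) →
      (⋃ k, (run k).facts i).Finite := by
    intro i B hB hD hfr
    refine finite_iUnion_of_fire S hB (fun k => (run k).facts i) ?_ fun k => ?_
    · simp only [h0]
      exact fun a ha => hD ha.2
    · generalize hs' : run (k + 1) = s'
      have hstep := hrun k
      rw [hs'] at hstep
      have hv := hvalid k
      have hfr' := fun j hj => hfr j hj k
      generalize run k = s at hstep hv hfr'
      cases hstep with
      | pull j σ hσ a ha hp hn => exact .inl rfl
      | fire j σ hσ θ hj hθ hfresh hF =>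
        by_cases hij : i = j
        · subst hij
          exact .inr (.inr ⟨σ, hσ, θ, fun b hb => hv.pulled_subset i σ (hθ b hb),
            fun y hy => (hfresh.1 y hy).imp fun n hn => hn.2, hv.homomorphismCheck.1 hF,
            State.facts_emit_self _ _ _⟩)
        · exact .inl (State.facts_emit_of_ne s hij _)
      | resume j hj a ha hn =>
        by_cases hij : i = j + 1
        · subst hij
          exact .inr (.inl ⟨_, hfr' j rfl a ha, State.facts_emit_self _ _ _⟩)
        · exact .inl (State.facts_emit_of_ne s hij _)
  induction i with
  | zero => exact main _ _ (finite_database D) subset_rfl fun j hj => by omega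
  | succ i ih =>
    refine main _ _ ((finite_database D).union (ih.image (Atom.map GTerm.freeze)))
      Set.subset_union_left fun j hj k a ha => ?_
    obtain rfl : j = i := by omega
    exact .inr ⟨a, Set.mem_iUnion.2 ⟨k, ha⟩, rfl⟩

theorem streamingChaseTerminates [Nonempty C] (h : 1 ≤ maxRes) :
    StreamingChaseTerminates D S HomomorphismCheckS maxRes := by
  rintro ⟨run, h0, hrun⟩
  have hvalid : ∀ k, (run k).Valid D S maxRes := by
    intro k
    induction k with
    | zero => rw [h0]; exact State.valid_init h
    | succ k ih => exact ih.step (hrun k)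
  refine not_finite_iUnion_of_ssubset (fun k => (run k).total)
    (fun k => (hvalid k).total_ssubset (hrun k)) ?_
  refine ((Set.finite_Iic maxRes).prod (((S.finite_toSet.image some).insert none).prod
    ((Set.finite_Iic maxRes).biUnion fun i _ =>
      finite_iUnion_facts h0 hrun hvalid i))).subset ?_
  rintro ⟨i, o, a⟩ hx
  obtain ⟨k, hk⟩ := Set.mem_iUnion.1 hx
  have ha : a ∈ (run k).facts i := by
    cases o with
    | none => exact hk
    | some σ => exact (hvalid k).pulled_subset i σ hk
  have hi := ((hvalid k).range i a ha).2
  refine ⟨hi, ?_, Set.mem_biUnion hi (Set.mem_iUnion.2 ⟨k, ha⟩)⟩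
  cases o with
  | none => exact .inl rfl
  | some σ => exact .inr ⟨σ, (hvalid k).mem_of_pulled i σ a hk, rfl⟩

/-- In a final state each node has pulled every fact relevant to its body, so a homomorphism into
the facts is one into the pulled facts, and only the firing condition can block it. -/
theorem State.Valid.parsimoniouslyClosed {s : State ar C V} (hs : s.Valid D S maxRes)
    (hend : ∀ s', ¬ SStep S HomomorphismCheckS maxRes s s') {i : ℕ} (hi : 1 ≤ i ∧ i ≤ maxRes) :
    ParsimoniouslyClosed S (s.facts i) := by
  refine parsimoniouslyClosed_of_blocked hs.finite_labels fun σ hσ θ hθ hf hc => ?_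
  refine hend _ (.fire s i σ hσ θ hi (fun b hb => ?_) hf (hs.homomorphismCheck.2 hc))
  by_contra hn
  exact hend _ (.pull s i σ hσ _ (hθ b hb) ⟨b, hb, rfl⟩ hn)

theorem State.Valid.iterationChain {s : State ar C V} (hs : s.Valid D S maxRes)
    (hend : ∀ s', ¬ SStep S HomomorphismCheckS maxRes s s') {r : ℕ} (hr : r + 1 ≤ maxRes) :
    IterationChain D S r (s.facts (r + 1)) := by
  induction r with
  | zero => exact .zero _ hs.database_subset (hs.parsimoniouslyClosed hend ⟨le_rfl, hr⟩)
  | succ r ih =>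
    refine .succ r _ _ (ih (by omega)) ?_ (hs.parsimoniouslyClosed hend ⟨by omega, hr⟩)
    rintro _ ⟨a, ha, rfl⟩
    by_contra hn
    exact hend _ (.resume s (r + 1) ⟨by omega, by omega⟩ a ha hn)

end Pipeline

end StreamingChase

theorem mainTheorem1 {P C V : Type*} [Nonempty C] (ar : P → ℕ)
    (D : Finset (StreamingChase.Atom ar C)) (S : Finset (StreamingChase.Rule ar C V))
    (hS : StreamingChase.Shy S) (q : StreamingChase.BCQ ar C V) :
    (∃ I, StreamingChase.IsPChaseR D S (StreamingChase.numVars q + 1) I) ∧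
    (∃ J, StreamingChase.IsStreamingChase D S StreamingChase.HomomorphismCheckS
      (StreamingChase.numVars q + 1) J) ∧
    StreamingChase.StreamingChaseTerminates D S StreamingChase.HomomorphismCheckS
      (StreamingChase.numVars q + 1) ∧
    ∀ I J, StreamingChase.IsPChaseR D S (StreamingChase.numVars q + 1) I →
      StreamingChase.IsStreamingChase D S StreamingChase.HomomorphismCheckS
        (StreamingChase.numVars q + 1) J →
      (StreamingChase.Entails I q ↔ StreamingChase.Entails J q) ∧
      (StreamingChase.Entails (StreamingChase.ochase D S) q ↔ StreamingChase.Entails J q) := by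
  open StreamingChase in
  have hterm : StreamingChaseTerminates D S HomomorphismCheckS (numVars q + 1) :=
    streamingChaseTerminates (Nat.le_add_left 1 _)
  refine ⟨exists_isPChaseR D S _, ?_, hterm, ?_⟩
  · obtain ⟨s, hs, hend⟩ := exists_terminal _ _ hterm
    exact ⟨_, s, hs, hend, rfl⟩
  · rintro I J hI ⟨s, hs, hend, rfl⟩
    have hv := State.valid_of_reachable (Nat.le_add_left 1 _) hs
    obtain ⟨h, hh⟩ := hv.sound
    obtain ⟨h', hh'⟩ := hI.exists_mapsToOChase
    -- Iterations `1` to `numVars q + 1` form a chain of index `numVars q`, exactly enough for the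
    -- nulls of the query.
    have hJq : Entails (ochase D S) q ↔ Entails (s.facts (numVars q + 1)) q :=
      ⟨(hv.iterationChain hend le_rfl).entails hS, (hh _).entails⟩
    have hIq : Entails (ochase D S) q ↔ Entails I q :=
      ⟨hI.iterationChain.entails hS, hh'.entails⟩
    exact ⟨hIq.symm.trans hJq, hJq⟩
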